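/- Let $E$ be a (real) Banach lattice with closed unit ball $B_E$, and let $(x_\alpha)$ be a net in $E$ whose set of terms $A=\{x_\alpha\}$ is either almost order bounded (for every $\varepsilon>0$ there is $u\in E^+$ with $A\subseteq[-u,u]+\varepsilon B_E$) or relatively weakly compact (the closure of $A$ in the weak topology of $E$ is weakly compact). Then $(x_\alpha)$ is $uaw$-null, i.e. $|x_\alpha|\wedge u\to 0$ weakly for every $u\in E^+$, if and only if $|x_\alpha|\to 0$ weakly. -/

import Mathlib

open Filter Topology
open scoped Pointwise

/-- The net (more generally, the family along a filter `l`) `x` converges to `a` in the weak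
topology `σ(E, E')` of `E`. -/
def WeaklyConvergesTo {ι E : Type*} [NormedAddCommGroup E] [NormedSpace ℝ E]
    (x : ι → E) (l : Filter ι) (a : E) : Prop :=
  Tendsto (fun i => toWeakSpace ℝ E (x i)) l (𝓝 (toWeakSpace ℝ E a))

/-- Unbounded absolute weak convergence of `x` to `a` along `l`: for every `u ≥ 0`, the family
`|x i - a| ⊓ u` converges weakly to `0`. -/
def UawConvergesTo {ι E : Type*} [NormedAddCommGroup E] [NormedSpace ℝ E] [Lattice E]
    (x : ι → E) (l : Filter ι) (a : E) : Prop :=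
  ∀ u : E, 0 ≤ u → WeaklyConvergesTo (fun i => |x i - a| ⊓ u) l 0

/-- A set is almost order bounded if for every `ε > 0` it is contained in `[-u, u] + ε B` for some
`u ≥ 0`, where `B` is the closed unit ball. -/
def IsAlmostOrderBounded {E : Type*} [NormedAddCommGroup E] [NormedSpace ℝ E] [Lattice E]
    (A : Set E) : Prop :=
  ∀ ε : ℝ, 0 < ε → ∃ u : E, 0 ≤ u ∧ A ⊆ Set.Icc (-u) u + ε • Metric.closedBall (0 : E) 1

/-- A set is relatively weakly compact if its closure in the weak topology is weakly compact. -/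
def IsRelativelyWeaklyCompact {E : Type*} [NormedAddCommGroup E] [NormedSpace ℝ E]
    (A : Set E) : Prop :=
  IsCompact (closure (toWeakSpace ℝ E '' A))

/-! Since `|x| = |x| ⊓ u + (|x| - u)⁺`, the forward direction needs only this: for positive `f` and
`ε > 0` some `u ≥ 0` has `f (|x| - u)⁺ ≤ ε` on all of `A`. Positive functionals suffice, every
functional being a difference of two. The converse is `0 ≤ |x| ⊓ u ≤ |x|`.

If `A` is almost order bounded, the bound on `(|x| - u)⁺` is immediate. If `A` is relatively weakly
compact and no `u` works, recursively chosen terms `x n` dominate disjoint `v n ≥ 0` with `f (v n)`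
bounded away from zero. Restricting `f` to the bands of the `v n` gives functionals `h n` with `∑ |h
n x| ≤ f |x|` and `f (v n) ≤ h n (x n)`: an operator into `ℓ¹`. Schur's theorem there forces `h n (x
n) → 0`, a contradiction. -/

/-! ### Disjointness in vector lattices -/

section LatticeGroup

variable {E : Type*} [AddCommGroup E] [Lattice E] [IsOrderedAddMonoid E]

/-- Riesz decomposition. -/
theorem exists_add_eq_of_le_add {a b y : E} (ha : 0 ≤ a) (hb : 0 ≤ b) (hy : 0 ≤ y)
    (h : y ≤ a + b) : ∃ y₁ y₂, 0 ≤ y₁ ∧ y₁ ≤ a ∧ 0 ≤ y₂ ∧ y₂ ≤ b ∧ y₁ + y₂ = y := by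
  refine ⟨y ⊓ a, y - y ⊓ a, le_inf hy ha, inf_le_right, sub_nonneg.2 inf_le_left, ?_, by abel⟩
  rw [sub_inf, sub_self]
  exact sup_le hb (sub_le_iff_le_add'.2 h)

theorem add_inf_le_inf_add_inf {a b c : E} (ha : 0 ≤ a) (hb : 0 ≤ b) (hc : 0 ≤ c) :
    (a + b) ⊓ c ≤ a ⊓ c + b ⊓ c := by
  obtain ⟨y₁, y₂, h₁, h₁a, h₂, h₂b, h⟩ :=
    exists_add_eq_of_le_add ha hb (le_inf (add_nonneg ha hb) hc) (inf_le_left (b := c))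
  have hyc : y₁ + y₂ ≤ c := h ▸ inf_le_right
  rw [← h]
  exact add_le_add (le_inf h₁a ((le_add_of_nonneg_right h₂).trans hyc))
    (le_inf h₂b ((le_add_of_nonneg_left h₁).trans hyc))

theorem sum_inf_eq_zero {κ : Type*} {a : κ → E} {c : E} (ha : ∀ i, 0 ≤ a i) (hc : 0 ≤ c)
    (s : Finset κ) (h : ∀ i ∈ s, a i ⊓ c = 0) : (∑ i ∈ s, a i) ⊓ c = 0 := by
  classical
  induction s using Finset.induction_on with
  | empty => simpa using hc
  | insert i s hi ih =>
    rw [Finset.sum_insert hi]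
    refine le_antisymm ?_ (le_inf (add_nonneg (ha i) (Finset.sum_nonneg fun j _ => ha j)) hc)
    refine (add_inf_le_inf_add_inf (ha i) (Finset.sum_nonneg fun j _ => ha j) hc).trans ?_
    rw [h i (Finset.mem_insert_self i s), ih fun j hj => h j (Finset.mem_insert_of_mem hj),
      add_zero]

/-- A finite sum of disjoint positive elements equals their supremum. -/
theorem sum_le_of_disjoint {κ : Type*} {a : κ → E} {y : E} (ha : ∀ i, 0 ≤ a i) (hy : 0 ≤ y)
    (h : Pairwise fun i j => a i ⊓ a j = 0) (hay : ∀ i, a i ≤ y) (s : Finset κ) :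
    ∑ i ∈ s, a i ≤ y := by
  classical
  induction s using Finset.induction_on with
  | empty => simpa using hy
  | insert i s hi ih =>
    have h0 := sum_inf_eq_zero ha (ha i) s fun j hj => h (ne_of_mem_of_not_mem hj hi)
    rw [Finset.sum_insert hi, add_comm, ← inf_add_sup, h0, zero_add]
    exact sup_le ih (hay i)

theorem posPart_sub_le {x w u : E} (hw : |w| ≤ u) : (|x| - u)⁺ ≤ |x - w| := by
  refine sup_le ?_ (abs_nonneg _)
  rw [sub_le_iff_le_add]
  calc |x| = |(x - w) + w| := by rw [sub_add_cancel]
    _ ≤ |x - w| + |w| := abs_add_le _ _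
    _ ≤ |x - w| + u := by gcongr

theorem inf_add_posPart_sub (a u : E) : a ⊓ u + (a - u)⁺ = a := by
  rw [inf_eq_sub_posPart_sub]; abel

variable [Module ℝ E] [IsOrderedModule ℝ E]

omit [IsOrderedAddMonoid E] in
theorem smul_inf_of_pos {c : ℝ} (hc : 0 < c) (a b : E) : c • (a ⊓ b) = c • a ⊓ c • b :=
  (OrderIso.smulRight hc : E ≃o E).map_inf a b

omit [IsOrderedAddMonoid E] in
theorem smul_sup_of_pos {c : ℝ} (hc : 0 < c) (a b : E) : c • (a ⊔ b) = c • a ⊔ c • b :=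
  (OrderIso.smulRight hc : E ≃o E).map_sup a b

omit [IsOrderedAddMonoid E] in
theorem abs_smul_of_pos {c : ℝ} (hc : 0 < c) (a : E) : |c • a| = c • |a| := by
  rw [abs, abs, smul_sup_of_pos hc, smul_neg]

omit [IsOrderedAddMonoid E] in
theorem smul_inf_smul_eq_zero {a b : E} {c : ℝ} (hc : 0 ≤ c) (h : a ⊓ b = 0) :
    c • a ⊓ c • b = 0 := by
  rcases hc.eq_or_lt with rfl | hc
  · simp
  · rw [← smul_inf_of_pos hc, h, smul_zero]

/-- `t • (b - s • a)⁺ ≤ (a - t • b)⁻` because `s * t ≥ 1`, and positive and negative parts are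
disjoint. -/
theorem posPart_inf_posPart_eq_zero {a b : E} {s t : ℝ} (ht : 0 < t) (ht1 : t ≤ 1)
    (hst : 1 ≤ s * t) (ha : 0 ≤ a) : (a - t • b)⁺ ⊓ (b - s • a)⁺ = 0 := by
  have h0 : 0 ≤ (a - t • b)⁺ ⊓ (b - s • a)⁺ := le_inf (posPart_nonneg _) (posPart_nonneg _)
  refine le_antisymm ?_ h0
  have h1 : t • ((a - t • b)⁺ ⊓ (b - s • a)⁺) ≤ 0 := by
    rw [← posPart_inf_negPart_eq_zero (a - t • b)]
    refine le_inf ?_ ?_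
    · refine le_trans ?_ (inf_le_left (b := (b - s • a)⁺))
      simpa using smul_le_smul_of_nonneg_right ht1 h0
    · refine (smul_le_smul_of_nonneg_left inf_le_right ht.le).trans ?_
      rw [posPart_def, negPart_def, smul_sup_of_pos ht, smul_zero, neg_sub, smul_sub, smul_smul]
      refine sup_le_sup_right (sub_le_sub_left ?_ _) _
      rw [mul_comm]
      simpa using smul_le_smul_of_nonneg_right hst ha
  exact (smul_le_smul_iff_of_pos_left ht).1 (by simpa using h1)

end LatticeGroup

/-! ### Domination by positive functionals -/

section BanachLattice

variable {E : Type*} [NormedAddCommGroup E] [NormedSpace ℝ E] [Lattice E] [IsOrderedAddMonoid E]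
  [HasSolidNorm E]

omit [NormedSpace ℝ E] in
theorem norm_le_norm_of_nonneg_of_le {a b : E} (ha : 0 ≤ a) (h : a ≤ b) : ‖a‖ ≤ ‖b‖ :=
  norm_le_norm_of_abs_le_abs (by rwa [abs_of_nonneg ha, abs_of_nonneg (ha.trans h)])

/-- The Riesz–Kantorovich formula for the positive part of a functional, on the positive cone. -/
noncomputable def rieszSup (f : E →L[ℝ] ℝ) (x : E) : ℝ := sSup (f '' Set.Icc 0 x)

theorem bddAbove_image_Icc (f : E →L[ℝ] ℝ) (x : E) : BddAbove (f '' Set.Icc 0 x) := by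
  refine ⟨‖f‖ * ‖x‖, ?_⟩
  rintro _ ⟨y, hy, rfl⟩
  exact ((le_abs_self _).trans (f.le_opNorm y)).trans
    (mul_le_mul_of_nonneg_left (norm_le_norm_of_nonneg_of_le hy.1 hy.2) (norm_nonneg _))

theorem le_rieszSup (f : E →L[ℝ] ℝ) {x y : E} (hy : 0 ≤ y) (h : y ≤ x) : f y ≤ rieszSup f x :=
  le_csSup (bddAbove_image_Icc f x) ⟨y, ⟨hy, h⟩, rfl⟩

omit [IsOrderedAddMonoid E] [HasSolidNorm E] in
theorem rieszSup_le (f : E →L[ℝ] ℝ) {x : E} {c : ℝ} (hx : 0 ≤ x)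
    (h : ∀ y, 0 ≤ y → y ≤ x → f y ≤ c) : rieszSup f x ≤ c := by
  refine csSup_le ⟨f 0, 0, ⟨le_rfl, hx⟩, rfl⟩ ?_
  rintro _ ⟨y, hy, rfl⟩
  exact h y hy.1 hy.2

theorem rieszSup_nonneg (f : E →L[ℝ] ℝ) {x : E} (hx : 0 ≤ x) : 0 ≤ rieszSup f x := by
  simpa using le_rieszSup f le_rfl hx

theorem rieszSup_le_norm (f : E →L[ℝ] ℝ) {x : E} (hx : 0 ≤ x) : rieszSup f x ≤ ‖f‖ * ‖x‖ :=
  rieszSup_le f hx fun y hy h => ((le_abs_self _).trans (f.le_opNorm y)).trans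
    (mul_le_mul_of_nonneg_left (norm_le_norm_of_nonneg_of_le hy h) (norm_nonneg _))

theorem rieszSup_add (f : E →L[ℝ] ℝ) {a b : E} (ha : 0 ≤ a) (hb : 0 ≤ b) :
    rieszSup f (a + b) = rieszSup f a + rieszSup f b := by
  refine le_antisymm (rieszSup_le f (add_nonneg ha hb) fun y hy h => ?_) ?_
  · obtain ⟨y₁, y₂, h₁, h₁a, h₂, h₂b, rfl⟩ := exists_add_eq_of_le_add ha hb hy h
    rw [map_add]
    exact add_le_add (le_rieszSup f h₁ h₁a) (le_rieszSup f h₂ h₂b)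
  · rw [← le_sub_iff_add_le]
    refine rieszSup_le f ha fun y hy h => ?_
    rw [le_sub_comm]
    refine rieszSup_le f hb fun z hz h' => ?_
    rw [le_sub_iff_add_le, ← map_add]
    exact le_rieszSup f (add_nonneg hz hy) (by rw [add_comm a]; exact add_le_add h' h)

/-- Additivity on the cone makes the difference depend only on `a - b`, so the extension to `E` is
additive. -/
theorem rieszSup_posPart_sub_negPart (f : E →L[ℝ] ℝ) {a b : E} (ha : 0 ≤ a) (hb : 0 ≤ b) :
    rieszSup f (a - b)⁺ - rieszSup f (a - b)⁻ = rieszSup f a - rieszSup f b := by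
  rw [sub_eq_sub_iff_add_eq_add, ← rieszSup_add f (posPart_nonneg _) hb,
    ← rieszSup_add f ha (negPart_nonneg _)]
  congr 1
  rw [← sub_eq_sub_iff_add_eq_add, posPart_sub_negPart]

/-- The extension of `rieszSup f` to an additive map. -/
noncomputable def posPartHom (f : E →L[ℝ] ℝ) : E →+ ℝ where
  toFun x := rieszSup f x⁺ - rieszSup f x⁻
  map_zero' := by simp
  map_add' x y := by
    have h := rieszSup_posPart_sub_negPart f
      (add_nonneg (posPart_nonneg x) (posPart_nonneg y))
      (add_nonneg (negPart_nonneg x) (negPart_nonneg y))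
    rw [add_sub_add_comm, posPart_sub_negPart, posPart_sub_negPart,
      rieszSup_add f (posPart_nonneg x) (posPart_nonneg y),
      rieszSup_add f (negPart_nonneg x) (negPart_nonneg y)] at h
    rw [h]; ring

theorem posPartHom_of_nonneg (f : E →L[ℝ] ℝ) {x : E} (hx : 0 ≤ x) :
    posPartHom f x = rieszSup f x := by
  have h0 : rieszSup f (0 : E) = 0 := by simp [rieszSup]
  change rieszSup f x⁺ - rieszSup f x⁻ = _
  rw [posPart_of_nonneg hx, negPart_of_nonneg hx, h0, sub_zero]

theorem abs_posPartHom_le (f : E →L[ℝ] ℝ) (x : E) : |posPartHom f x| ≤ ‖f‖ * ‖x‖ := by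
  have hp : ‖x⁺‖ ≤ ‖x‖ := by
    rw [← norm_abs_eq_norm x]
    exact norm_le_norm_of_nonneg_of_le (posPart_nonneg x) (sup_le (le_abs_self x) (abs_nonneg x))
  have hn : ‖x⁻‖ ≤ ‖x‖ := by
    rw [← norm_abs_eq_norm x]
    exact norm_le_norm_of_nonneg_of_le (negPart_nonneg x) (sup_le (neg_le_abs x) (abs_nonneg x))
  refine abs_sub_le_of_nonneg_of_le (rieszSup_nonneg f (posPart_nonneg x)) ?_
    (rieszSup_nonneg f (negPart_nonneg x)) ?_
  · exact (rieszSup_le_norm f (posPart_nonneg x)).trans (by gcongr)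
  · exact (rieszSup_le_norm f (negPart_nonneg x)).trans (by gcongr)

/-- Every continuous functional on a Banach lattice is dominated on the positive cone by a positive
continuous functional. -/
theorem exists_pos_functional_ge (f : E →L[ℝ] ℝ) :
    ∃ g : E →L[ℝ] ℝ, (∀ x, 0 ≤ x → 0 ≤ g x) ∧ ∀ x, 0 ≤ x → f x ≤ g x := by
  have hc : Continuous (posPartHom f) :=
    AddMonoidHomClass.continuous_of_bound (posPartHom f) ‖f‖ fun x => abs_posPartHom_le f x
  refine ⟨(posPartHom f).toRealLinearMap hc, fun x hx => ?_, fun x hx => ?_⟩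
  · rw [AddMonoidHom.coe_toRealLinearMap, posPartHom_of_nonneg f hx]
    exact rieszSup_nonneg f hx
  · rw [AddMonoidHom.coe_toRealLinearMap, posPartHom_of_nonneg f hx]
    exact le_rieszSup f hx le_rfl

end BanachLattice

/-! ### Schur's theorem by Baire category -/

section Schur

/-- A form of Schur's theorem: if all the subseries of the series `∑ z k n` tend to zero as
`k → ∞`, then the terms `z k n` are uniformly small for large `k` and `n`. -/
theorem exists_forall_abs_le_of_tendsto_tsum_zero (z : ℕ → ℕ → ℝ) (hz : ∀ k, Summable (z k))
    (h : ∀ a : ℕ → Bool, Tendsto (fun k => ∑' n, bif a n then z k n else 0) atTop (𝓝 0))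
    {ε : ℝ} (hε : 0 < ε) : ∃ m, ∀ᶠ n in atTop, ∀ k ≥ m, |z k n| ≤ ε := by
  set Φ : ℕ → (ℕ → Bool) → ℝ := fun (k : ℕ) (a : ℕ → Bool) => ∑' n, bif a n then z k n else 0 with hΦ
  have hle : ∀ k (a : ℕ → Bool) n, ‖bif a n then z k n else 0‖ ≤ |z k n| := by
    intro k a n
    cases a n <;> simp
  have hcont : ∀ k, Continuous (Φ k) := by
    intro k
    refine continuous_tsum (u := fun n => |z k n|) (fun n => ?_) (hz k).abs fun n a => hle k a n
    exact (continuous_of_discreteTopology (f := fun b : Bool => bif b then z k n else 0)).comp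
      (continuous_apply n)
  have hsum : ∀ k a, Summable fun n => bif (a : ℕ → Bool) n then z k n else 0 := fun k a =>
    (Summable.of_norm_bounded (hz k).abs (hle k a))
  -- Baire's theorem on the Cantor space: one of these closed sets has an interior point `a`. For
  -- large `n`, both values of coordinate `n` keep `a` in that set, and the two sums differ by `z k
  -- n`.
  obtain ⟨m, a, ha⟩ := nonempty_interior_of_iUnion_of_closed
    (f := fun m : ℕ => {a : ℕ → Bool | ∀ k ≥ m, |Φ k a| ≤ ε / 2}) (fun m => by
      simp only [Set.ofPred_forall]
      exact isClosed_iInter fun k => isClosed_iInter fun _ =>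
        isClosed_le (hcont k).abs continuous_const) (by
      refine Set.eq_univ_of_forall fun a => Set.mem_iUnion.2 ?_
      have := (h a).abs
      rw [abs_zero] at this
      exact eventually_atTop.1 (this.eventually_le_const (half_pos hε)))
  have hupd : ∀ b : Bool, Tendsto (fun n => Function.update a n b) atTop (𝓝 a) := by
    intro b
    refine tendsto_pi_nhds.2 fun i => tendsto_const_nhds.congr' ?_
    filter_upwards [eventually_gt_atTop i] with n hn
    rw [Function.update_of_ne hn.ne]
  refine ⟨m, ?_⟩
  filter_upwards [(hupd true).eventually (mem_interior_iff_mem_nhds.1 ha),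
    (hupd false).eventually (mem_interior_iff_mem_nhds.1 ha)] with n ht hf k hk
  have hdiff : Φ k (Function.update a n true) - Φ k (Function.update a n false) = z k n := by
    rw [hΦ]
    simp only
    rw [← (hsum k _).tsum_sub (hsum k _), tsum_eq_single n]
    · simp
    · intro i hi
      simp [Function.update_of_ne hi]
  have h1 := abs_sub (Φ k (Function.update a n true)) (Φ k (Function.update a n false))
  rw [hdiff] at h1
  linarith [ht k hk, hf k hk]

end Schur

/-! ### Weak compactness and operators into `ℓ¹` -/

section Weak

variable {E : Type*} [NormedAddCommGroup E] [NormedSpace ℝ E]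

theorem continuous_weakSpace_apply (f : E →L[ℝ] ℝ) :
    Continuous fun x : WeakSpace ℝ E => f ((toWeakSpace ℝ E).symm x) :=
  WeakBilin.eval_continuous (topDualPairing ℝ E).flip f

theorem weaklyConvergesTo_zero_iff {ι : Type*} {x : ι → E} {l : Filter ι} :
    WeaklyConvergesTo x l 0 ↔ ∀ f : E →L[ℝ] ℝ, Tendsto (fun i => f (x i)) l (𝓝 0) := by
  rw [WeaklyConvergesTo]
  constructor
  · intro h f
    have := ((continuous_weakSpace_apply f).tendsto _).comp h
    simpa [Function.comp_def] using this
  · intro h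
    have hind : IsInducing fun (x : WeakSpace ℝ E) (f : E →L[ℝ] ℝ) =>
        f ((toWeakSpace ℝ E).symm x) := ⟨rfl⟩
    exact hind.tendsto_nhds_iff.2 (tendsto_pi_nhds.2 fun f => by
      simpa [Function.comp_def] using h f)

theorem IsRelativelyWeaklyCompact.exists_norm_le [CompleteSpace E] {A : Set E}
    (hA : IsRelativelyWeaklyCompact A) : ∃ C, ∀ x ∈ A, ‖x‖ ≤ C := by
  obtain ⟨C, hC⟩ := banach_steinhaus (𝕜 := ℝ) (𝕜₂ := ℝ)
    (g := fun x : A => NormedSpace.inclusionInDoubleDual ℝ E (x : E)) (fun f => by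
      obtain ⟨C, hC⟩ := (hA.image (continuous_weakSpace_apply f)).isBounded.exists_norm_le
      exact ⟨C, fun x => hC _ ⟨_, subset_closure ⟨x, x.2, rfl⟩, by simp⟩⟩)
  refine ⟨C, fun x hx => ?_⟩
  have := hC ⟨x, hx⟩
  rwa [← (NormedSpace.inclusionInDoubleDualLi ℝ).norm_map x]

/-- If the functionals `h n` define a continuous operator into `ℓ¹`, then they tend to zero
uniformly on relatively weakly compact sets. -/
theorem IsRelativelyWeaklyCompact.tendsto_apply_zero {A : Set E}
    (hA : IsRelativelyWeaklyCompact A) (h : ℕ → E →L[ℝ] ℝ) (C : ℝ)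
    (hC : ∀ x (s : Finset ℕ), ∑ n ∈ s, |h n x| ≤ C * ‖x‖) (x : ℕ → E) (hx : ∀ n, x n ∈ A) :
    Tendsto (fun n => h n (x n)) atTop (𝓝 0) := by
  have habs : ∀ y, Summable fun n => |h n y| := fun y =>
    summable_of_sum_le (fun n => abs_nonneg _) (hC y)
  have hsum : ∀ y, Summable fun n => h n y := fun y => (habs y).of_abs
  have hle : ∀ (a : ℕ → Bool) y n, |bif a n then h n y else 0| ≤ |h n y| := by
    intro a y n
    cases a n <;> simp
  have hsub : ∀ (a : ℕ → Bool) y, Summable fun n => bif a n then h n y else 0 := fun a y =>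
    Summable.of_norm_bounded (habs y) (hle a y)
  have hfun : ∀ a : ℕ → Bool, ∃ g : E →L[ℝ] ℝ, ∀ y, g y = ∑' n, bif a n then h n y else 0 := by
    intro a
    refine ⟨LinearMap.mkContinuous
      { toFun := fun y => ∑' n, bif a n then h n y else 0
        map_add' := fun y y' => ?_
        map_smul' := fun c y => ?_ } C fun y => ?_, fun y => rfl⟩
    · rw [← (hsub a y).tsum_add (hsub a y')]
      congr 1 with n
      cases a n <;> simp
    · rw [RingHom.id_apply, smul_eq_mul, ← tsum_mul_left]
      congr 1 with n
      cases a n <;> simp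
    · change ‖∑' n, bif a n then h n y else 0‖ ≤ _
      refine tsum_of_norm_bounded (habs y).hasSum (hle a y) |>.trans ?_
      exact (habs y).tsum_le_of_sum_le (hC y)
  have hH : Continuous fun y : WeakSpace ℝ E => fun n => h n ((toWeakSpace ℝ E).symm y) :=
    continuous_pi fun n => continuous_weakSpace_apply (h n)
  have hmem : ∀ n, toWeakSpace ℝ E (x n) ∈ closure (toWeakSpace ℝ E '' A) := fun n =>
    subset_closure ⟨x n, hx n, rfl⟩
  refine tendsto_of_subseq_tendsto fun ns hns => ?_
  -- The image in `ℕ → ℝ` is compact and metrizable, so a subsequence converges there without weak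
  -- sequential compactness in `E`.
  obtain ⟨_, ⟨w, -, rfl⟩, φ, hφ, hlim⟩ := (hA.image hH).tendsto_subseq
    (x := fun k n => h n (x (ns k))) fun k => ⟨_, hmem (ns k), by simp⟩
  refine ⟨φ, ?_⟩
  set w' : E := (toWeakSpace ℝ E).symm w with hw'
  -- Every weak cluster point of the subsequence has the coordinates of `w'`, so a `g` determined by
  -- the coordinates takes the value `g w'` there.
  have hg : ∀ g : E →L[ℝ] ℝ, (∀ y y', (∀ n, h n y = h n y') → g y = g y') →
      Tendsto (fun k => g (x (ns (φ k)))) atTop (𝓝 (g w')) := by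
    intro g hginv
    refine (tendsto_iff_ultrafilter _ _ _).2 fun 𝒰 h𝒰 => ?_
    obtain ⟨v, -, hv⟩ := hA.ultrafilter_le_nhds
      (𝒰.map fun k => toWeakSpace ℝ E (x (ns (φ k))))
      (le_principal_iff.2 (Filter.mem_map.2 (univ_mem' fun k => hmem _)))
    have hv' : Tendsto (fun k => toWeakSpace ℝ E (x (ns (φ k)))) 𝒰 (𝓝 v) := hv
    have h1 := ((hH.tendsto v).comp hv')
    have h2 := tendsto_nhds_unique h1 (hlim.mono_left h𝒰)
    have h3 := ((continuous_weakSpace_apply g).tendsto v).comp hv'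
    rw [hginv _ w' fun n => congrFun h2 n] at h3
    exact h3
  rw [Metric.tendsto_atTop']
  intro ε hε
  obtain ⟨m, hm⟩ := exists_forall_abs_le_of_tendsto_tsum_zero
    (fun k n => h n (x (ns (φ k)) - w')) (fun k => hsum _) (fun a => by
      obtain ⟨g, hga⟩ := hfun a
      have := (hg g fun y y' hy => by rw [hga, hga]; simp only [hy]).sub_const (g w')
      rw [sub_self] at this
      exact this.congr fun k => by rw [← map_sub, hga]) (half_pos (half_pos hε))
  have hns' : Tendsto (fun k => ns (φ k)) atTop atTop := hns.comp hφ.tendsto_atTop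
  have hw0 : ∀ᶠ n in atTop, |h n w'| < ε / 2 := by
    have := (hsum w').tendsto_atTop_zero.abs
    rw [abs_zero] at this
    exact this.eventually_lt_const (half_pos hε)
  obtain ⟨N, hN⟩ := eventually_atTop.1 ((hns'.eventually (hm.and hw0)).and (eventually_ge_atTop m))
  refine ⟨N, fun k hk => ?_⟩
  obtain ⟨⟨h1, h2⟩, h3⟩ := hN k hk.le
  have h4 := h1 k h3
  rw [map_sub] at h4
  rw [Real.dist_eq, sub_zero]
  have h5 := abs_sub_abs_le_abs_sub (h (ns (φ k)) (x (ns (φ k)))) (h (ns (φ k)) w')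
  linarith

end Weak

/-! ### Band restrictions and disjoint sequences -/

section

variable {E : Type*} [NormedAddCommGroup E] [NormedSpace ℝ E] [Lattice E] [IsOrderedAddMonoid E]
  [IsOrderedModule ℝ E] [HasSolidNorm E]

/-- The value at `|x|` of the restriction of a positive functional `f` to the band generated by
`v`. -/
noncomputable def bandSup (f : E →L[ℝ] ℝ) (v x : E) : ℝ := ⨆ k : ℕ, f (|x| ⊓ (k : ℝ) • v)

omit [IsOrderedModule ℝ E] [HasSolidNorm E] in
theorem map_le_map_of_pos {f : E →L[ℝ] ℝ} (hf : ∀ x, 0 ≤ x → 0 ≤ f x) {a b : E} (h : a ≤ b) :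
    f a ≤ f b := by
  simpa using hf (b - a) (sub_nonneg.2 h)

variable {f : E →L[ℝ] ℝ} (hf : ∀ x, 0 ≤ x → 0 ≤ f x) {v : E} (hv : 0 ≤ v)

include hf

omit [IsOrderedModule ℝ E] [HasSolidNorm E] in
theorem le_bandSup (v x : E) (k : ℕ) : f (|x| ⊓ (k : ℝ) • v) ≤ bandSup f v x :=
  le_ciSup (f := fun k : ℕ => f (|x| ⊓ (k : ℝ) • v))
    ⟨f |x|, by rintro _ ⟨k, rfl⟩; exact map_le_map_of_pos hf inf_le_left⟩ k

omit [IsOrderedModule ℝ E] [HasSolidNorm E] in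
theorem bandSup_le_apply_abs (v x : E) : bandSup f v x ≤ f |x| :=
  ciSup_le fun _ => map_le_map_of_pos hf inf_le_left

include hv

omit [HasSolidNorm E] in
theorem bandSup_nonneg (x : E) : 0 ≤ bandSup f v x :=
  (hf _ (le_inf (abs_nonneg x) (smul_nonneg (Nat.cast_nonneg 0) hv))).trans (le_bandSup hf v x 0)

omit [HasSolidNorm E] in
theorem tendsto_bandSup (x : E) :
    Tendsto (fun k : ℕ => f (|x| ⊓ (k : ℝ) • v)) atTop (𝓝 (bandSup f v x)) := by
  refine tendsto_atTop_ciSup (fun k l hkl => map_le_map_of_pos hf (inf_le_inf_left _ ?_))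
    ⟨f |x|, by rintro _ ⟨k, rfl⟩; exact map_le_map_of_pos hf inf_le_left⟩
  exact smul_le_smul_of_nonneg_right (Nat.cast_le.2 hkl) hv

omit [HasSolidNorm E] in
theorem bandSup_add_le (x y : E) : bandSup f v (x + y) ≤ bandSup f v x + bandSup f v y := by
  refine ciSup_le fun k => ?_
  refine le_trans ?_ (add_le_add (le_bandSup hf v x k) (le_bandSup hf v y k))
  rw [← map_add]
  exact map_le_map_of_pos hf ((inf_le_inf_right _ (abs_add_le x y)).trans
    (add_inf_le_inf_add_inf (abs_nonneg x) (abs_nonneg y) (smul_nonneg (Nat.cast_nonneg k) hv)))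

omit [HasSolidNorm E] in
theorem bandSup_smul_le {c : ℝ} (hc : 0 < c) (x : E) :
    bandSup f v (c • x) ≤ c * bandSup f v x := by
  refine ciSup_le fun k => ?_
  obtain ⟨l, hl⟩ := exists_nat_ge ((k : ℝ) / c)
  have hle : |c • x| ⊓ (k : ℝ) • v ≤ c • (|x| ⊓ (l : ℝ) • v) := by
    rw [smul_inf_of_pos hc, abs_smul_of_pos hc, smul_smul]
    exact inf_le_inf_left _ (smul_le_smul_of_nonneg_right ((div_le_iff₀' hc).1 hl) hv)
  calc f (|c • x| ⊓ (k : ℝ) • v) ≤ f (c • (|x| ⊓ (l : ℝ) • v)) := map_le_map_of_pos hf hle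
    _ = c * f (|x| ⊓ (l : ℝ) • v) := by simp
    _ ≤ c * bandSup f v x := mul_le_mul_of_nonneg_left (le_bandSup hf v x l) hc.le

omit [HasSolidNorm E] in
theorem bandSup_smul {c : ℝ} (hc : 0 < c) (x : E) : bandSup f v (c • x) = c * bandSup f v x := by
  refine le_antisymm (bandSup_smul_le hf hv hc x) ?_
  have := bandSup_smul_le hf hv (inv_pos.2 hc) (c • x)
  rwa [inv_smul_smul₀ hc.ne', le_inv_mul_iff₀ hc] at this

/-- The restriction of `f` to the band generated by `v` is attained at each `x₀` by a functional of
no larger modulus. -/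
theorem exists_functional_eq_bandSup (x₀ : E) :
    ∃ h : E →L[ℝ] ℝ, (∀ x, |h x| ≤ bandSup f v x) ∧ h x₀ = bandSup f v x₀ := by
  have h0 : bandSup f v 0 = 0 :=
    le_antisymm (by simpa using bandSup_le_apply_abs hf v 0) (bandSup_nonneg hf hv 0)
  obtain ⟨g, hg₀, hg⟩ : ∃ g : E →ₗ[ℝ] ℝ, g x₀ = bandSup f v x₀ ∧ ∀ x, g x ≤ bandSup f v x := by
    rcases eq_or_ne x₀ 0 with rfl | hx₀
    · exact ⟨0, by simp [h0], fun x => by simpa using bandSup_nonneg hf hv x⟩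
    -- Hahn–Banach from the line through `x₀`, with the sublinear majorant `bandSup f v`.
    · obtain ⟨g, hg₀, hg⟩ := exists_extension_of_le_sublinear
        (LinearPMap.mkSpanSingleton (K := ℝ) x₀ (bandSup f v x₀) hx₀) (bandSup f v)
        (fun c hc x => bandSup_smul hf hv hc x) (bandSup_add_le hf hv) (by
          rintro ⟨x, hx⟩
          obtain ⟨c, rfl⟩ := Submodule.mem_span_singleton.1 hx
          refine (LinearPMap.mkSpanSingleton'_apply _ _ _ c hx).le.trans ?_
          rw [RingHom.id_apply, smul_eq_mul]
          rcases lt_trichotomy c 0 with hc | rfl | hc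
          · exact (mul_nonpos_of_nonpos_of_nonneg hc.le (bandSup_nonneg hf hv x₀)).trans
              (bandSup_nonneg hf hv _)
          · simp [h0]
          · exact (bandSup_smul hf hv hc x₀).ge)
      refine ⟨g, ?_, hg⟩
      have := hg₀ ⟨x₀, Submodule.mem_span_singleton_self x₀⟩
      rw [this]
      exact LinearPMap.mkSpanSingleton_apply ℝ ℝ hx₀ (bandSup f v x₀)
  have habs : ∀ x, |g x| ≤ bandSup f v x := fun x => by
    refine abs_le'.2 ⟨hg x, ?_⟩
    have := hg (-x)
    rwa [map_neg, bandSup, abs_neg] at this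
  refine ⟨g.mkContinuous ‖f‖ fun x => ?_, habs, hg₀⟩
  refine ((habs x).trans (bandSup_le_apply_abs hf v x)).trans ?_
  rw [← norm_abs_eq_norm x]
  exact (le_abs_self _).trans (f.le_opNorm _)

omit hv

omit [HasSolidNorm E] in
theorem sum_bandSup_le {v : ℕ → E} (hv : ∀ n, 0 ≤ v n)
    (hdisj : Pairwise fun i j => v i ⊓ v j = 0) (x : E) (s : Finset ℕ) :
    ∑ n ∈ s, bandSup f (v n) x ≤ f |x| := by
  -- For fixed `k` the truncations `|x| ⊓ k • v n` are disjoint and below `|x|`.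
  refine le_of_tendsto' (tendsto_finsetSum s fun n _ => tendsto_bandSup hf (hv n) x) fun k => ?_
  rw [← map_sum]
  have h0 : ∀ n, 0 ≤ |x| ⊓ (k : ℝ) • v n := fun n =>
    le_inf (abs_nonneg x) (smul_nonneg (Nat.cast_nonneg k) (hv n))
  refine map_le_map_of_pos hf (sum_le_of_disjoint h0 (abs_nonneg x) (fun i j hij => ?_)
    (fun n => inf_le_left) s)
  refine le_antisymm ?_ (le_inf (h0 i) (h0 j))
  exact (inf_le_inf inf_le_right inf_le_right).trans
    (smul_inf_smul_eq_zero (Nat.cast_nonneg k) (hdisj hij)).le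

/-- Positive disjoint sequences in the solid hull of a relatively weakly compact set are weakly
null. -/
theorem tendsto_apply_zero_of_disjoint {A : Set E} (hA : IsRelativelyWeaklyCompact A)
    {x v : ℕ → E} (hx : ∀ n, x n ∈ A) (hv : ∀ n, 0 ≤ v n) (hvx : ∀ n, v n ≤ |x n|)
    (hdisj : Pairwise fun i j => v i ⊓ v j = 0) : Tendsto (fun n => f (v n)) atTop (𝓝 0) := by
  choose h hle heq using fun n => exists_functional_eq_bandSup hf (hv n) (x n)
  refine squeeze_zero (fun n => hf _ (hv n)) (fun n => ?_)
    (hA.tendsto_apply_zero h ‖f‖ (fun y s => ?_) x hx)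
  · rw [heq n]
    simpa [inf_eq_right.2 (hvx n)] using le_bandSup hf (v n) (x n) 1
  · refine ((Finset.sum_le_sum fun n _ => hle n y).trans (sum_bandSup_le hf hv hdisj y s)).trans ?_
    rw [← norm_abs_eq_norm y]
    exact (le_abs_self _).trans (f.le_opNorm _)

omit hf

/-- The terms obtained by repeatedly applying `c` to multiples of the sum of the moduli of the
preceding terms are `c (4 ^ n • absSum c n)`. -/
noncomputable def absSum (c : E → E) : ℕ → E
  | 0 => 0
  | n + 1 => absSum c n + |c ((4 : ℝ) ^ n • absSum c n)|

omit [IsOrderedModule ℝ E] [HasSolidNorm E] in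
theorem absSum_nonneg (c : E → E) (n : ℕ) : 0 ≤ absSum c n := by
  induction n with
  | zero => exact le_rfl
  | succ n ih => exact add_nonneg ih (abs_nonneg _)

omit [IsOrderedModule ℝ E] [HasSolidNorm E] in
theorem abs_le_absSum (c : E → E) {n m : ℕ} (h : n < m) :
    |c ((4 : ℝ) ^ n • absSum c n)| ≤ absSum c m := by
  have hmono : Monotone (absSum c) := monotone_nat_of_le_succ fun n =>
    le_add_of_nonneg_right (abs_nonneg _)
  exact (le_add_of_nonneg_left (absSum_nonneg c n)).trans (hmono h)

include hf

theorem IsRelativelyWeaklyCompact.exists_apply_posPart_le [CompleteSpace E] {A : Set E}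
    (hA : IsRelativelyWeaklyCompact A) {ε : ℝ} (hε : 0 < ε) :
    ∃ u, 0 ≤ u ∧ ∀ x ∈ A, f (|x| - u)⁺ ≤ ε := by
  by_contra! hcon
  obtain ⟨C, hC⟩ := hA.exists_norm_le
  have hcon' : ∀ u : E, ∃ x, 0 ≤ u → x ∈ A ∧ ε < f (|x| - u)⁺ := fun u => by
    by_cases hu : 0 ≤ u
    · obtain ⟨x, hx⟩ := hcon u hu
      exact ⟨x, fun _ => hx⟩
    · exact ⟨0, fun h => absurd h hu⟩
  choose c hc using hcon'
  have hS : ∀ n, 0 ≤ (4 : ℝ) ^ n • absSum c n := fun n =>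
    smul_nonneg (by positivity) (absSum_nonneg c n)
  set x : ℕ → E := fun n => c ((4 : ℝ) ^ n • absSum c n) with hx
  have hxA : ∀ n, x n ∈ A := fun n => (hc _ (hS n)).1
  have hxε : ∀ n, ε < f (|x n| - (4 : ℝ) ^ n • absSum c n)⁺ := fun n => (hc _ (hS n)).2
  have hsum : Summable fun n => ((1 / 2 : ℝ) ^ n) • |x n| := by
    refine Summable.of_norm_bounded (g := fun n => (1 / 2 : ℝ) ^ n * C)
      (summable_geometric_two.mul_right C) fun n => ?_
    rw [norm_smul, norm_abs_eq_norm, norm_pow, Real.norm_of_nonneg (by norm_num)]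
    exact mul_le_mul_of_nonneg_left (hC _ (hxA n)) (by positivity)
  have hnn : ∀ n, 0 ≤ ((1 / 2 : ℝ) ^ n) • |x n| := fun n =>
    smul_nonneg (by positivity) (abs_nonneg _)
  set y : E := ∑' n, ((1 / 2 : ℝ) ^ n) • |x n| with hy
  have hy0 : 0 ≤ y := tsum_nonneg hnn
  have hxy : ∀ n, ((1 / 2 : ℝ) ^ n) • |x n| ≤ y := fun n => hsum.le_tsum n fun i _ => hnn i
  have hy' : ∀ n : ℕ, 0 ≤ ((1 / 2 : ℝ) ^ n) • y := fun n => smul_nonneg (by positivity) hy0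
  -- For `n < m`, the multiple `4 ^ m` controls `|x n|` inside `v m`, while `y ≥ 2⁻ᵐ • |x m|`
  -- controls `|x m|` inside `v n`. Disjointness follows from `4 ^ m * (2⁻ⁿ * 2⁻ᵐ) ≥ 1`; subtracting
  -- `2⁻ⁿ • y` costs only `2⁻ⁿ * f y → 0`.
  set v : ℕ → E := fun n => (|x n| - (4 : ℝ) ^ n • absSum c n - ((1 / 2 : ℝ) ^ n) • y)⁺ with hv
  have hlt : ∀ n m, n < m → v n ⊓ v m = 0 := by
    intro n m hnm
    refine le_antisymm ?_ (le_inf (posPart_nonneg _) (posPart_nonneg _))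
    have h1 : v n ≤ (|x n| - ((1 / 2 : ℝ) ^ n * (1 / 2) ^ m) • |x m|)⁺ := by
      refine posPart_mono (sub_le_sub ?_ ?_)
      · exact sub_le_self _ (hS n)
      · rw [mul_smul]
        exact smul_le_smul_of_nonneg_left (hxy m) (by positivity)
    have h2 : v m ≤ (|x m| - (4 : ℝ) ^ m • |x n|)⁺ := by
      refine posPart_mono ((sub_le_self _ (hy' m)).trans (sub_le_sub_left ?_ _))
      exact smul_le_smul_of_nonneg_left (abs_le_absSum c hnm) (by positivity)
    refine (inf_le_inf h1 h2).trans (posPart_inf_posPart_eq_zero (by positivity) ?_ ?_ (abs_nonneg _)).le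
    · exact mul_le_one₀ (pow_le_one₀ (by norm_num) (by norm_num)) (by positivity)
        (pow_le_one₀ (by norm_num) (by norm_num))
    · calc (1 : ℝ) = 4 ^ m * ((1 / 2) ^ m * (1 / 2) ^ m) := by
            rw [← mul_pow, ← mul_pow]; norm_num
        _ ≤ 4 ^ m * ((1 / 2) ^ n * (1 / 2) ^ m) := by
            have : (1 / 2 : ℝ) ^ m ≤ (1 / 2) ^ n :=
              pow_le_pow_of_le_one (by norm_num) (by norm_num) hnm.le
            gcongr
  have hdisj : Pairwise fun i j => v i ⊓ v j = 0 := by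
    intro i j hij
    rcases lt_or_gt_of_ne hij with h | h
    · exact hlt i j h
    · rw [inf_comm]; exact hlt j i h
  have hvx : ∀ n, v n ≤ |x n| := fun n =>
    sup_le ((sub_le_self _ (hy' n)).trans (sub_le_self _ (hS n))) (abs_nonneg _)
  have hlim := tendsto_apply_zero_of_disjoint hf hA hxA (fun n => posPart_nonneg _) hvx hdisj
  have hlim2 : Tendsto (fun n : ℕ => f (v n) + (1 / 2 : ℝ) ^ n * f y) atTop (𝓝 (0 + 0 * f y)) :=
    hlim.add ((tendsto_pow_atTop_nhds_zero_of_lt_one (by norm_num) (by norm_num)).mul_const _)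
  refine absurd (ge_of_tendsto' hlim2 fun n => ?_) (by simpa using hε)
  refine (hxε n).le.trans ?_
  have hle : (|x n| - (4 : ℝ) ^ n • absSum c n)⁺ ≤ v n + ((1 / 2 : ℝ) ^ n) • y := by
    refine sup_le ?_ (add_nonneg (posPart_nonneg _) (hy' n))
    rw [← sub_le_iff_le_add]
    exact le_posPart _
  simpa using map_le_map_of_pos hf hle

omit [IsOrderedModule ℝ E] in
theorem IsAlmostOrderBounded.exists_apply_posPart_le {A : Set E} (hA : IsAlmostOrderBounded A)
    {ε : ℝ} (hε : 0 < ε) : ∃ u, 0 ≤ u ∧ ∀ x ∈ A, f (|x| - u)⁺ ≤ ε := by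
  -- The `+ 1` keeps the radius meaningful when `f = 0`.
  obtain ⟨u, hu, hAu⟩ := hA (ε / (‖f‖ + 1)) (by positivity)
  refine ⟨u, hu, fun x hx => ?_⟩
  obtain ⟨w, hw, z, hz, rfl⟩ := hAu hx
  have hz' : ‖z‖ ≤ ε / (‖f‖ + 1) := by
    obtain ⟨b, hb, rfl⟩ := hz
    rw [norm_smul, Real.norm_of_nonneg (by positivity)]
    exact mul_le_of_le_one_right (by positivity) (by simpa using hb)
  have hle := posPart_sub_le (x := w + z) (abs_le'.2 ⟨hw.2, neg_le.1 hw.1⟩)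
  rw [add_sub_cancel_left] at hle
  calc f (|w + z| - u)⁺ ≤ f |z| := map_le_map_of_pos hf hle
    _ ≤ ‖f‖ * ‖z‖ := by
      rw [← norm_abs_eq_norm z]
      exact (le_abs_self _).trans (f.le_opNorm _)
    _ ≤ (‖f‖ + 1) * (ε / (‖f‖ + 1)) := by gcongr; linarith
    _ = ε := by field_simp

end

/-! ### Reduction to positive functionals and conclusion -/

section

variable {E : Type*} [NormedAddCommGroup E] [NormedSpace ℝ E] [Lattice E] [IsOrderedAddMonoid E]
  [HasSolidNorm E]

/-- Weak convergence to zero can be tested on positive functionals. -/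
theorem weaklyConvergesTo_zero_of_forall_pos {ι : Type*} {l : Filter ι} {x : ι → E}
    (h : ∀ f : E →L[ℝ] ℝ, (∀ x, 0 ≤ x → 0 ≤ f x) → Tendsto (fun i => f (x i)) l (𝓝 0)) :
    WeaklyConvergesTo x l 0 := by
  refine weaklyConvergesTo_zero_iff.2 fun f => ?_
  obtain ⟨g, hg, hfg⟩ := exists_pos_functional_ge f
  have h1 := h g hg
  have h2 := h (g - f) fun x hx => by simpa using hfg x hx
  simpa using h1.sub h2

end

theorem mainTheorem8 {E : Type*} [NormedAddCommGroup E] [NormedSpace ℝ E] [CompleteSpace E]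
    [Lattice E] [IsOrderedAddMonoid E] [IsOrderedModule ℝ E] [HasSolidNorm E]
    {ι : Type*} [Preorder ι] [IsDirectedOrder ι] [Nonempty ι] (x : ι → E)
    (hx : IsAlmostOrderBounded (Set.range x) ∨ IsRelativelyWeaklyCompact (Set.range x)) :
    UawConvergesTo x atTop 0 ↔ WeaklyConvergesTo (fun i => |x i|) atTop 0 := by
  constructor
  · intro h
    refine weaklyConvergesTo_zero_of_forall_pos fun f hf => ?_
    rw [Metric.tendsto_nhds]
    intro ε hε
    obtain ⟨u, hu, hxu⟩ : ∃ u, 0 ≤ u ∧ ∀ y ∈ Set.range x, f (|y| - u)⁺ ≤ ε / 2 :=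
      hx.elim (fun h => h.exists_apply_posPart_le hf (half_pos hε))
        (fun h => h.exists_apply_posPart_le hf (half_pos hε))
    have hlim := weaklyConvergesTo_zero_iff.1 (h u hu) f
    filter_upwards [hlim.eventually_lt_const (half_pos hε)] with i hi
    rw [sub_zero] at hi
    rw [Real.dist_eq, sub_zero, abs_of_nonneg (hf _ (abs_nonneg _)),
      ← inf_add_posPart_sub |x i| u, map_add]
    linarith [hxu (x i) ⟨i, rfl⟩]
  · intro h u hu
    simp only [sub_zero]
    refine weaklyConvergesTo_zero_of_forall_pos fun f hf => ?_
    exact squeeze_zero (fun i => hf _ (le_inf (abs_nonneg _) hu))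
      (fun i => map_le_map_of_pos hf inf_le_left) (weaklyConvergesTo_zero_iff.1 h f)
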